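/- Let $\alpha\in[1,2)$, let $\mathbb T=\{x\in\mathbb R^2:|x|=1\}$ be the unit circle (with arc length coordinate $\theta$), $\Omega=\mathbb T\times(0,1)$ with points $z=(\theta,r)$ and measure $dz=d\theta\,dr$, $\Gamma=\mathbb T\times\{1\}$, $w=r^\alpha$ and $A=\operatorname{diag}(1,r^\alpha)$; all functions are real valued. Let $H^1(\Omega;w)$ be the space of all $u\in L^2(\Omega)$ whose weak gradient $\nabla u=(\partial_\theta u,\partial_r u)$ satisfies $\int_\Omega\nabla u\cdot A\nabla u\,dz=\int_\Omega\big((\partial_\theta u)^2+r^\alpha(\partial_r u)^2\big)dz<\infty$, with inner product $\int_\Omega(\nabla u\cdot A\nabla v+uv)\,dz$. Let $C^\infty_\Gamma(\Omega)$ be the set of all $u\in C^\infty(\overline\Omega)$ whose support has positive distance from $\Gamma$, and let $H^1_\Gamma(\Omega;w)$ be the closure of $C^\infty_\Gamma(\Omega)$ in $H^1(\Omega;w)$, equipped with the norm $\|u\|_{H^1_\Gamma(\Omega;w)}=\big(\int_\Omega\nabla u\cdot A\nabla u\,dz\big)^{1/2}$. **Lemma 2.5.** The embedding $H^1_\Gamma(\Omega;w)\hookrightarrow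 L^2(\Omega)$, $u\mapsto u$, is compact; that is, it is an injective linear map and the image of every bounded subset of $H^1_\Gamma(\Omega;w)$ is relatively compact in $L^2(\Omega)$. -/

import Mathlib

open MeasureTheory Set
open scoped ContDiff ENNReal

noncomputable section

namespace DegCyl

instance factTwoPiPos : Fact (0 < 2 * Real.pi) := ⟨Real.two_pi_pos⟩

/-- The infinite cylinder `𝕋 × ℝ`, where the unit circle `𝕋` is parametrized by arc length
(`θ` modulo `2π`).  A point is `z = (θ, r)`. -/
abbrev Cyl : Type := AddCircle (2 * Real.pi) × ℝ

/-- The measure `dz = dθ dr` of the domain `Ω = 𝕋 × (0, 1)`. -/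
def mu : Measure Cyl :=
  (volume : Measure (AddCircle (2 * Real.pi))).prod ((volume : Measure ℝ).restrict (Ioo 0 1))

/-- The weighted measure `r ^ α dz` on `Ω`. -/
def muW (α : Set.Ico (1 : ℝ) 2) : Measure Cyl :=
  mu.withDensity fun z => ENNReal.ofReal (z.2 ^ (α : ℝ))

/-- `L²(Ω)` (real valued). -/
abbrev L2 : Type := Lp ℝ 2 mu

/-- The weighted space `L²(Ω; r ^ α dz)`. -/
abbrev L2W (α : Set.Ico (1 : ℝ) 2) : Type := Lp ℝ 2 (muW α)

/-- Smoothness of a function on the cylinder `𝕋 × ℝ`: its `2π`-periodic lift to `ℝ × ℝ` is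
`C^∞`. -/
def Smooth (φ : Cyl → ℝ) : Prop :=
  ContDiff ℝ ∞ fun p : ℝ × ℝ => φ ((p.1 : AddCircle (2 * Real.pi)), p.2)

/-- The classical angular derivative `∂_θ φ`. -/
def dTheta (φ : Cyl → ℝ) (z : Cyl) : ℝ :=
  deriv (fun t : ℝ => φ (z.1 + (t : AddCircle (2 * Real.pi)), z.2)) 0

/-- The classical radial derivative `∂_r φ`. -/
def dR (φ : Cyl → ℝ) (z : Cyl) : ℝ :=
  deriv (fun s : ℝ => φ (z.1, s)) z.2

/-- Test functions: `C_c^∞(Ω)`, `Ω = 𝕋 × (0, 1)`. -/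
structure IsTest (φ : Cyl → ℝ) : Prop where
  smooth : Smooth φ
  compact : HasCompactSupport φ
  support : tsupport φ ⊆ univ ×ˢ Ioo (0 : ℝ) 1

/-- `C_Γ^∞(Ω)`: (restrictions to `𝕋 × [0, 1]` of) smooth functions on the cylinder whose support
in `𝕋 × [0, 1]` has positive distance from `Γ = 𝕋 × {1}`.  Nothing is required at `r = 0`. -/
structure IsCGamma (φ : Cyl → ℝ) : Prop where
  smooth : Smooth φ
  vanish : ∃ δ > 0, ∀ z : Cyl, z.2 ∈ Icc (0 : ℝ) 1 → 1 - δ < z.2 → φ z = 0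

/-- `g = (g₁, g₂)` is the weak (distributional) gradient `(∂_θ u, ∂_r u)` of `u` in `Ω`. -/
def IsWeakGrad (u g₁ g₂ : Cyl → ℝ) : Prop :=
  ∀ φ : Cyl → ℝ, IsTest φ →
    ∫ z, u z * dTheta φ z ∂mu = - ∫ z, g₁ z * φ z ∂mu ∧
    ∫ z, u z * dR φ z ∂mu = - ∫ z, g₂ z * φ z ∂mu

/-! ### Elementary facts about smooth functions on the cylinder -/

lemma isOpenQuotientMap_cover :
    IsOpenQuotientMap fun p : ℝ × ℝ => (((p.1 : AddCircle (2 * Real.pi)), p.2) : Cyl) :=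
  (QuotientAddGroup.isOpenQuotientMap_mk
    (N := AddSubgroup.zmultiples (2 * Real.pi))).prodMap IsOpenQuotientMap.id

lemma Smooth.continuous {φ : Cyl → ℝ} (h : Smooth φ) : Continuous φ :=
  isOpenQuotientMap_cover.continuous_comp_iff.1 (ContDiff.continuous h)

lemma Smooth.dR_lift {φ : Cyl → ℝ} (h : Smooth φ) (p : ℝ × ℝ) :
    HasDerivAt (fun s : ℝ => φ ((p.1 : AddCircle (2 * Real.pi)), s))
      (fderiv ℝ (fun p : ℝ × ℝ => φ ((p.1 : AddCircle (2 * Real.pi)), p.2)) p (0, 1)) p.2 := by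
  have h1 : HasFDerivAt (fun p : ℝ × ℝ => φ ((p.1 : AddCircle (2 * Real.pi)), p.2)) _ (p.1, p.2) :=
    ((ContDiff.differentiable h (by simp)) p).hasFDerivAt
  have h2 : HasDerivAt (fun s : ℝ => (p.1, s)) ((0 : ℝ), (1 : ℝ)) p.2 :=
    (hasDerivAt_const p.2 p.1).prodMk (hasDerivAt_id p.2)
  exact h1.comp_hasDerivAt p.2 h2

lemma Smooth.dTheta_lift {φ : Cyl → ℝ} (h : Smooth φ) (p : ℝ × ℝ) :
    HasDerivAt (fun t : ℝ => φ ((p.1 : AddCircle (2 * Real.pi)) + (t : AddCircle (2 * Real.pi)), p.2))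
      (fderiv ℝ (fun p : ℝ × ℝ => φ ((p.1 : AddCircle (2 * Real.pi)), p.2)) p (1, 0)) 0 := by
  have h1 : HasFDerivAt (fun p : ℝ × ℝ => φ ((p.1 : AddCircle (2 * Real.pi)), p.2))
      (fderiv ℝ (fun p : ℝ × ℝ => φ ((p.1 : AddCircle (2 * Real.pi)), p.2)) p) (p.1 + 0, p.2) := by
    rw [add_zero]
    exact ((ContDiff.differentiable h (by simp)) p).hasFDerivAt
  have h2 : HasDerivAt (fun t : ℝ => (p.1 + t, p.2)) ((1 : ℝ), (0 : ℝ)) 0 :=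
    ((hasDerivAt_id (0 : ℝ)).const_add p.1).prodMk (hasDerivAt_const 0 p.2)
  have h3 := h1.comp_hasDerivAt 0 h2
  simpa [Function.comp_def] using h3

lemma Smooth.hasDerivAt_dR {φ : Cyl → ℝ} (h : Smooth φ) (z : Cyl) :
    HasDerivAt (fun s : ℝ => φ (z.1, s)) (dR φ z) z.2 := by
  obtain ⟨p, rfl⟩ := isOpenQuotientMap_cover.surjective z
  exact (h.dR_lift p).differentiableAt.hasDerivAt

lemma Smooth.hasDerivAt_dTheta {φ : Cyl → ℝ} (h : Smooth φ) (z : Cyl) :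
    HasDerivAt (fun t : ℝ => φ (z.1 + (t : AddCircle (2 * Real.pi)), z.2)) (dTheta φ z) 0 := by
  obtain ⟨p, rfl⟩ := isOpenQuotientMap_cover.surjective z
  exact (h.dTheta_lift p).differentiableAt.hasDerivAt

lemma Smooth.continuous_dR {φ : Cyl → ℝ} (h : Smooth φ) : Continuous (dR φ) := by
  refine isOpenQuotientMap_cover.continuous_comp_iff.1 ?_
  have : (dR φ ∘ fun p : ℝ × ℝ => (((p.1 : AddCircle (2 * Real.pi)), p.2) : Cyl)) =
      fun p => fderiv ℝ (fun p : ℝ × ℝ => φ ((p.1 : AddCircle (2 * Real.pi)), p.2)) p (0, 1) :=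
    funext fun p => (h.dR_lift p).deriv
  rw [this]
  exact (ContDiff.continuous_fderiv h (by simp)).clm_apply continuous_const

lemma Smooth.continuous_dTheta {φ : Cyl → ℝ} (h : Smooth φ) : Continuous (dTheta φ) := by
  refine isOpenQuotientMap_cover.continuous_comp_iff.1 ?_
  have : (dTheta φ ∘ fun p : ℝ × ℝ => (((p.1 : AddCircle (2 * Real.pi)), p.2) : Cyl)) =
      fun p => fderiv ℝ (fun p : ℝ × ℝ => φ ((p.1 : AddCircle (2 * Real.pi)), p.2)) p (1, 0) :=
    funext fun p => (h.dTheta_lift p).deriv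
  rw [this]
  exact (ContDiff.continuous_fderiv h (by simp)).clm_apply continuous_const

lemma Smooth.add {φ ψ : Cyl → ℝ} (hφ : Smooth φ) (hψ : Smooth ψ) : Smooth (φ + ψ) :=
  ContDiff.add hφ hψ

lemma Smooth.smul {φ : Cyl → ℝ} (c : ℝ) (hφ : Smooth φ) : Smooth (c • φ) :=
  ContDiff.const_smul c hφ

lemma dTheta_add {φ ψ : Cyl → ℝ} (hφ : Smooth φ) (hψ : Smooth ψ) :
    dTheta (φ + ψ) = dTheta φ + dTheta ψ :=
  funext fun z => ((hφ.hasDerivAt_dTheta z).add (hψ.hasDerivAt_dTheta z)).deriv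

lemma dR_add {φ ψ : Cyl → ℝ} (hφ : Smooth φ) (hψ : Smooth ψ) :
    dR (φ + ψ) = dR φ + dR ψ :=
  funext fun z => ((hφ.hasDerivAt_dR z).add (hψ.hasDerivAt_dR z)).deriv

lemma dTheta_smul {φ : Cyl → ℝ} (c : ℝ) (hφ : Smooth φ) : dTheta (c • φ) = c • dTheta φ :=
  funext fun z => ((hφ.hasDerivAt_dTheta z).const_smul c).deriv

lemma dR_smul {φ : Cyl → ℝ} (c : ℝ) (hφ : Smooth φ) : dR (c • φ) = c • dR φ :=
  funext fun z => ((hφ.hasDerivAt_dR z).const_smul c).deriv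

/-! ### The measures -/

instance : IsFiniteMeasure mu := by unfold mu; infer_instance

lemma ae_mem : ∀ᵐ z ∂mu, z.2 ∈ Ioo (0 : ℝ) 1 := by
  have h : ∀ᵐ r ∂((volume : Measure ℝ).restrict (Ioo 0 1)), r ∈ Ioo (0 : ℝ) 1 :=
    ae_restrict_mem measurableSet_Ioo
  exact Measure.quasiMeasurePreserving_snd.ae h

lemma measurable_weight (α : ℝ) : Measurable fun z : Cyl => ENNReal.ofReal (z.2 ^ α) := by
  fun_prop

lemma muW_le (α : Set.Ico (1 : ℝ) 2) : muW α ≤ mu := by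
  have h : muW α ≤ mu.withDensity 1 := by
    refine withDensity_mono ?_
    filter_upwards [ae_mem] with z hz
    have : z.2 ^ (α : ℝ) ≤ 1 :=
      Real.rpow_le_one hz.1.le hz.2.le (by linarith [α.2.1])
    simpa using this
  simpa using h

instance (α : Set.Ico (1 : ℝ) 2) : IsFiniteMeasure (muW α) :=
  isFiniteMeasure_of_le mu (muW_le α)

lemma integrable_muW_iff (α : Set.Ico (1 : ℝ) 2) (f : Cyl → ℝ) :
    Integrable f (muW α) ↔ Integrable (fun z => z.2 ^ (α : ℝ) * f z) mu := by
  rw [muW, integrable_withDensity_iff_integrable_smul' (measurable_weight _) (by simp)]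
  refine integrable_congr ?_
  filter_upwards [ae_mem] with z hz
  rw [ENNReal.toReal_ofReal (Real.rpow_nonneg hz.1.le _), smul_eq_mul]

lemma integral_muW (α : Set.Ico (1 : ℝ) 2) (f : Cyl → ℝ) :
    ∫ z, f z ∂(muW α) = ∫ z, z.2 ^ (α : ℝ) * f z ∂mu := by
  rw [muW, integral_withDensity_eq_integral_toReal_smul (measurable_weight _) (by simp)]
  refine integral_congr_ae ?_
  filter_upwards [ae_mem] with z hz
  rw [ENNReal.toReal_ofReal (Real.rpow_nonneg hz.1.le _), smul_eq_mul]

lemma exists_bound {f : Cyl → ℝ} (hf : Continuous f) : ∃ C, ∀ᵐ z ∂mu, ‖f z‖ ≤ C := by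
  obtain ⟨C, hC⟩ := (isCompact_univ.prod (isCompact_Icc (a := (0 : ℝ)) (b := 1))).exists_bound_of_continuousOn
    (s := (univ : Set (AddCircle (2 * Real.pi))) ×ˢ Icc (0 : ℝ) 1) hf.continuousOn
  refine ⟨C, ?_⟩
  filter_upwards [ae_mem] with z hz
  exact hC z ⟨mem_univ _, Ioo_subset_Icc_self hz⟩

lemma integrable_mul_of_continuous (u : L2) {f : Cyl → ℝ} (hf : Continuous f) :
    Integrable (fun z => u z * f z) mu := by
  obtain ⟨C, hC⟩ := exists_bound hf
  exact ((Lp.memLp u).integrable (by norm_num)).mul_bdd hf.aestronglyMeasurable hC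

lemma integrable_of_continuous {f : Cyl → ℝ} (hf : Continuous f) : Integrable f mu := by
  obtain ⟨C, hC⟩ := exists_bound hf
  exact Integrable.of_bound hf.aestronglyMeasurable C hC

lemma integrable_mul_test (α : Set.Ico (1 : ℝ) 2) (g : L2W α) {φ : Cyl → ℝ} (hφ : IsTest φ) :
    Integrable (fun z => g z * φ z) mu := by
  have hc : ContinuousOn (fun z : Cyl => φ z * z.2 ^ (-(α : ℝ))) (tsupport φ) := by
    refine hφ.smooth.continuous.continuousOn.mul ?_
    exact continuous_snd.continuousOn.rpow_const fun z hz => Or.inl (hφ.support hz).2.1.ne'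
  obtain ⟨C, hC⟩ := hφ.compact.isCompact.exists_bound_of_continuousOn hc
  have hb : ∀ z : Cyl, ‖φ z * z.2 ^ (-(α : ℝ))‖ ≤ max C 0 := by
    intro z
    by_cases hz : z ∈ tsupport φ
    · exact (hC z hz).trans (le_max_left _ _)
    · simp [image_eq_zero_of_notMem_tsupport hz]
  have hm : AEStronglyMeasurable (fun z : Cyl => φ z * z.2 ^ (-(α : ℝ))) (muW α) := by
    have := hφ.smooth.continuous.measurable
    exact Measurable.aestronglyMeasurable (by fun_prop)
  have hi : Integrable (fun z => g z * (φ z * z.2 ^ (-(α : ℝ)))) (muW α) :=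
    ((Lp.memLp g).integrable (by norm_num)).mul_bdd hm (Filter.Eventually.of_forall hb)
  refine ((integrable_muW_iff α _).1 hi).congr ?_
  filter_upwards [ae_mem] with z hz
  have : z.2 ^ (α : ℝ) * z.2 ^ (-(α : ℝ)) = 1 := by
    rw [← Real.rpow_add hz.1]; simp
  linear_combination (g z * φ z) * this

lemma ae_mu_of_ae_muW (α : Set.Ico (1 : ℝ) 2) {p : Cyl → Prop} (h : ∀ᵐ z ∂(muW α), p z) :
    ∀ᵐ z ∂mu, p z := by
  rw [muW, ae_withDensity_iff (measurable_weight _)] at h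
  filter_upwards [h, ae_mem] with z hz hz'
  exact hz (by simpa using Real.rpow_pos_of_pos hz'.1 _)

lemma integral_mul_zero {u φ : Cyl → ℝ} (h : u =ᵐ[mu] 0) : ∫ z, u z * φ z ∂mu = 0 :=
  integral_eq_zero_of_ae (h.mono fun z hz => by
    have : u z = 0 := hz
    simp [this])

lemma integral_mul_add {u v w φ : Cyl → ℝ} (h : w =ᵐ[mu] u + v)
    (hu : Integrable (fun z => u z * φ z) mu) (hv : Integrable (fun z => v z * φ z) mu) :
    ∫ z, w z * φ z ∂mu = (∫ z, u z * φ z ∂mu) + ∫ z, v z * φ z ∂mu := by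
  rw [← integral_add hu hv]
  refine integral_congr_ae (h.mono fun z hz => ?_)
  have : w z = u z + v z := hz
  simp only [this, add_mul]

lemma integral_mul_smul {a : ℝ} {u w φ : Cyl → ℝ} (h : w =ᵐ[mu] a • u) :
    ∫ z, w z * φ z ∂mu = a * ∫ z, u z * φ z ∂mu := by
  rw [← integral_const_mul]
  refine integral_congr_ae (h.mono fun z hz => ?_)
  have : w z = a * u z := hz
  simp only [this, mul_assoc]

/-! ### The space `H¹(Ω; w)` -/

/-- The Hilbert space `L²(Ω) × (L²(Ω) × L²(Ω; r ^ α dz))` of triples `(u, (g₁, g₂))`, with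
`‖(u, (g₁, g₂))‖² = ∫ u² + g₁² + r ^ α g₂² dz`. -/
abbrev Triple (α : Set.Ico (1 : ℝ) 2) : Type :=
  WithLp 2 (L2 × WithLp 2 (L2 × L2W α))

/-- The weighted energy space `H¹(Ω; w)`, `w = r ^ α`: all `u ∈ L²(Ω)` whose weak gradient
satisfies `∫ ∇u · A∇u dz = ∫ (∂_θ u)² + r ^ α (∂_r u)² dz < ∞`, each `u` being recorded together
with its weak gradient.  Inner product and norm are those of `Triple α`, that is
`(u, v) = ∫ u v + ∇u · A∇v dz`. -/
def H1W (α : Set.Ico (1 : ℝ) 2) : Submodule ℝ (Triple α) where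
  carrier := {x | IsWeakGrad x.fst x.snd.fst x.snd.snd}
  zero_mem' := by
    intro φ _
    have h1 : ((0 : Triple α).fst : Cyl → ℝ) =ᵐ[mu] 0 := Lp.coeFn_zero ..
    have h2 : ((0 : Triple α).snd.fst : Cyl → ℝ) =ᵐ[mu] 0 := Lp.coeFn_zero ..
    have h3 : ((0 : Triple α).snd.snd : Cyl → ℝ) =ᵐ[mu] 0 :=
      ae_mu_of_ae_muW α (Lp.coeFn_zero ..)
    constructor
    · rw [integral_mul_zero h1, integral_mul_zero h2, neg_zero]
    · rw [integral_mul_zero h1, integral_mul_zero h3, neg_zero]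
  add_mem' := by
    intro x y hx hy φ hφ
    have h1 : ((x + y).fst : Cyl → ℝ) =ᵐ[mu] x.fst + y.fst := Lp.coeFn_add ..
    have h2 : ((x + y).snd.fst : Cyl → ℝ) =ᵐ[mu] x.snd.fst + y.snd.fst := Lp.coeFn_add ..
    have h3 : ((x + y).snd.snd : Cyl → ℝ) =ᵐ[mu] x.snd.snd + y.snd.snd :=
      ae_mu_of_ae_muW α (Lp.coeFn_add ..)
    have ct := hφ.smooth.continuous_dTheta
    have cr := hφ.smooth.continuous_dR
    have c := hφ.smooth.continuous
    constructor
    · rw [integral_mul_add h1 (integrable_mul_of_continuous _ ct)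
          (integrable_mul_of_continuous _ ct),
        integral_mul_add h2 (integrable_mul_of_continuous _ c) (integrable_mul_of_continuous _ c),
        (hx φ hφ).1, (hy φ hφ).1, neg_add]
    · rw [integral_mul_add h1 (integrable_mul_of_continuous _ cr)
          (integrable_mul_of_continuous _ cr),
        integral_mul_add h3 (integrable_mul_test α _ hφ) (integrable_mul_test α _ hφ),
        (hx φ hφ).2, (hy φ hφ).2, neg_add]
  smul_mem' := by
    intro a x hx φ hφ
    have h1 : ((a • x).fst : Cyl → ℝ) =ᵐ[mu] a • x.fst := Lp.coeFn_smul ..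
    have h2 : ((a • x).snd.fst : Cyl → ℝ) =ᵐ[mu] a • x.snd.fst := Lp.coeFn_smul ..
    have h3 : ((a • x).snd.snd : Cyl → ℝ) =ᵐ[mu] a • x.snd.snd :=
      ae_mu_of_ae_muW α (Lp.coeFn_smul ..)
    constructor
    · rw [integral_mul_smul h1, integral_mul_smul h2, (hx φ hφ).1, mul_neg]
    · rw [integral_mul_smul h1, integral_mul_smul h3, (hx φ hφ).2, mul_neg]

/-- `C_Γ^∞(Ω)` as a subspace of `H¹(Ω; w)`: the elements `(φ, ∂_θ φ, ∂_r φ)`, `φ ∈ C_Γ^∞(Ω)`. -/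
def CGamma (α : Set.Ico (1 : ℝ) 2) : Submodule ℝ (H1W α) where
  carrier := {x | ∃ φ : Cyl → ℝ, IsCGamma φ ∧ (x : Triple α).fst =ᵐ[mu] φ ∧
    (x : Triple α).snd.fst =ᵐ[mu] dTheta φ ∧ (x : Triple α).snd.snd =ᵐ[muW α] dR φ}
  zero_mem' := by
    have d1 : dTheta (0 : Cyl → ℝ) = 0 := by ext z; simp [dTheta]
    have d2 : dR (0 : Cyl → ℝ) = 0 := by ext z; simp [dR]
    refine ⟨0, ⟨contDiff_const, 1, one_pos, fun _ _ _ => rfl⟩, Lp.coeFn_zero .., ?_, ?_⟩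
    · rw [d1]; exact Lp.coeFn_zero ..
    · rw [d2]; exact Lp.coeFn_zero ..
  add_mem' := by
    rintro x y ⟨φ, ⟨hφ, δ, hδ, hv⟩, h1, h2, h3⟩ ⟨ψ, ⟨hψ, ε, hε, hw⟩, k1, k2, k3⟩
    refine ⟨φ + ψ, ⟨hφ.add hψ, min δ ε, lt_min hδ hε, fun z hz hz' => ?_⟩, ?_, ?_, ?_⟩
    · have e1 := min_le_left δ ε
      have e2 := min_le_right δ ε
      simp [hv z hz (by linarith), hw z hz (by linarith)]
    · exact (Lp.coeFn_add ..).trans (h1.add k1)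
    · rw [dTheta_add hφ hψ]; exact (Lp.coeFn_add ..).trans (h2.add k2)
    · rw [dR_add hφ hψ]; exact (Lp.coeFn_add ..).trans (h3.add k3)
  smul_mem' := by
    rintro a x ⟨φ, ⟨hφ, δ, hδ, hv⟩, h1, h2, h3⟩
    refine ⟨a • φ, ⟨hφ.smul a, δ, hδ, fun z hz hz' => by simp [hv z hz hz']⟩, ?_, ?_, ?_⟩
    · exact (Lp.coeFn_smul ..).trans (h1.const_smul a)
    · rw [dTheta_smul a hφ]; exact (Lp.coeFn_smul ..).trans (h2.const_smul a)
    · rw [dR_smul a hφ]; exact (Lp.coeFn_smul ..).trans (h3.const_smul a)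

/-- `H¹_Γ(Ω; w)`: the closure of `C_Γ^∞(Ω)` in `H¹(Ω; w)`. -/
def H1WGamma (α : Set.Ico (1 : ℝ) 2) : Submodule ℝ (H1W α) :=
  (CGamma α).topologicalClosure

/-! ### The Poincaré inequality, which makes the gradient norm a norm -/

lemma poincare_slice {f f' : ℝ → ℝ} {α : ℝ} (hα : α ≤ 2) (hf : ∀ r, HasDerivAt f (f' r) r)
    (hf' : Continuous f') (h1 : f 1 = 0) (hα0 : 0 ≤ α) :
    ∫ r in Ioo (0 : ℝ) 1, f r ^ 2 ≤ 4 * ∫ r in Ioo (0 : ℝ) 1, r ^ α * f' r ^ 2 := by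
  have cf : Continuous f := continuous_iff_continuousAt.2 fun r => (hf r).continuousAt
  rw [← integral_Ioc_eq_integral_Ioo, ← integral_Ioc_eq_integral_Ioo,
    ← intervalIntegral.integral_of_le zero_le_one, ← intervalIntegral.integral_of_le zero_le_one]
  have hd : ∀ r ∈ uIcc (0 : ℝ) 1,
      HasDerivAt (fun r => r * f r ^ 2) (f r ^ 2 + 2 * (r * f r * f' r)) r := by
    intro r _
    have := (hasDerivAt_id r).mul ((hf r).pow 2)
    refine this.congr_deriv ?_
    simp only [id_eq, Nat.cast_ofNat, Nat.add_one_sub_one, pow_one, one_mul, Pi.pow_apply]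
    ring
  have e1 : ∫ r in (0 : ℝ)..1, (f r ^ 2 + 2 * (r * f r * f' r)) = 0 := by
    rw [intervalIntegral.integral_eq_sub_of_hasDerivAt hd
      (Continuous.intervalIntegrable (by fun_prop) _ _)]
    simp [h1]
  have e2 : 0 ≤ ∫ r in (0 : ℝ)..1, (f r + 2 * (r * f' r)) ^ 2 :=
    intervalIntegral.integral_nonneg zero_le_one fun r _ => sq_nonneg _
  have e3 : (fun r => (f r + 2 * (r * f' r)) ^ 2) =
      fun r => (2 * (f r ^ 2 + 2 * (r * f r * f' r)) - f r ^ 2) + 4 * (r ^ 2 * f' r ^ 2) := by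
    ext r; ring
  rw [e3, intervalIntegral.integral_add (Continuous.intervalIntegrable (by fun_prop) _ _)
      (Continuous.intervalIntegrable (by fun_prop) _ _),
    intervalIntegral.integral_sub (Continuous.intervalIntegrable (by fun_prop) _ _)
      (Continuous.intervalIntegrable (by fun_prop) _ _),
    intervalIntegral.integral_const_mul, intervalIntegral.integral_const_mul, e1] at e2
  have e4 : ∫ r in (0 : ℝ)..1, r ^ 2 * f' r ^ 2 ≤ ∫ r in (0 : ℝ)..1, r ^ α * f' r ^ 2 := by
    refine intervalIntegral.integral_mono_on_of_le_Ioo zero_le_one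
      (Continuous.intervalIntegrable (by fun_prop) _ _)
      (Continuous.intervalIntegrable ?_ _ _) fun r hr => ?_
    · exact (Real.continuous_rpow_const hα0).mul (by fun_prop)
    · have : r ^ (2 : ℝ) ≤ r ^ α := Real.rpow_le_rpow_of_exponent_ge hr.1 hr.2.le hα
      rw [Real.rpow_two] at this
      gcongr
  linarith

lemma norm_sq_Lp {ν : Measure Cyl} (f : Lp ℝ 2 ν) : ‖f‖ ^ 2 = ∫ z, f z ^ 2 ∂ν := by
  rw [← real_inner_self_eq_norm_sq, L2.inner_def]
  refine integral_congr_ae (Filter.Eventually.of_forall fun z => ?_)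
  simp [sq]

lemma poincare_smooth (α : Set.Ico (1 : ℝ) 2) {φ : Cyl → ℝ} (hφ : IsCGamma φ) :
    ∫ z, φ z ^ 2 ∂mu ≤ 4 * ∫ z, dR φ z ^ 2 ∂(muW α) := by
  have hα0 : (0 : ℝ) ≤ α := by linarith [α.2.1]
  have c := hφ.smooth.continuous
  have cr := hφ.smooth.continuous_dR
  have i1 : Integrable (fun z => φ z ^ 2) mu := integrable_of_continuous (by fun_prop)
  have i2 : Integrable (fun z : Cyl => z.2 ^ (α : ℝ) * dR φ z ^ 2) mu :=
    integrable_of_continuous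
      (((Real.continuous_rpow_const hα0).comp continuous_snd).mul (by fun_prop))
  rw [integral_muW]
  unfold mu at i1 i2 ⊢
  rw [integral_prod _ i1, integral_prod _ i2, ← integral_const_mul]
  refine integral_mono i1.integral_prod_left (i2.integral_prod_left.const_mul 4) fun θ => ?_
  obtain ⟨δ, hδ, hv⟩ := hφ.vanish
  exact poincare_slice α.2.2.le (f := fun r => φ (θ, r)) (f' := fun r => dR φ (θ, r))
    (fun r => hφ.smooth.hasDerivAt_dR (θ, r)) (by fun_prop)
    (hv (θ, 1) ⟨zero_le_one, le_rfl⟩ (by simpa using hδ)) hα0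

lemma poincare (α : Set.Ico (1 : ℝ) 2) (x : H1W α) (hx : x ∈ H1WGamma α) :
    ‖(x : Triple α).fst‖ ≤ 2 * ‖(x : Triple α).snd‖ := by
  have hcl : IsClosed {x : H1W α | ‖(x : Triple α).fst‖ ≤ 2 * ‖(x : Triple α).snd‖} := by
    have c1 : Continuous fun x : H1W α => (x : Triple α).fst :=
      (WithLp.fstL 2 ℝ L2 (WithLp 2 (L2 × L2W α))).continuous.comp continuous_subtype_val
    have c2 : Continuous fun x : H1W α => (x : Triple α).snd :=
      (WithLp.sndL 2 ℝ L2 (WithLp 2 (L2 × L2W α))).continuous.comp continuous_subtype_val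
    exact isClosed_le c1.norm (continuous_const.mul c2.norm)
  refine closure_minimal (s := (CGamma α : Set (H1W α))) ?_ hcl hx
  rintro y ⟨φ, hφ, h1, -, h3⟩
  have e1 : ‖(y : Triple α).fst‖ ^ 2 = ∫ z, φ z ^ 2 ∂mu := by
    rw [norm_sq_Lp]
    exact integral_congr_ae (h1.mono fun z hz => by simp only [hz])
  have e3 : ‖(y : Triple α).snd.snd‖ ^ 2 = ∫ z, dR φ z ^ 2 ∂(muW α) := by
    rw [norm_sq_Lp]
    exact integral_congr_ae (h3.mono fun z hz => by simp only [hz])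
  have e4 := WithLp.prod_norm_sq_eq_of_L2 (y : Triple α).snd
  have e5 := poincare_smooth α hφ
  refine (sq_le_sq₀ (norm_nonneg _) (by positivity)).1 ?_
  have := sq_nonneg ‖(y : Triple α).snd.fst‖
  rw [mul_pow, e4, e3, e1]
  nlinarith

/-- `H¹_Γ(Ω; w)` as a space of its own, normed by the gradient norm (not by the norm of
`H¹(Ω; w)`). -/
def HGamma (α : Set.Ico (1 : ℝ) 2) : Type := H1WGamma α

instance (α : Set.Ico (1 : ℝ) 2) : AddCommGroup (HGamma α) :=
  inferInstanceAs (AddCommGroup (H1WGamma α))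

instance (α : Set.Ico (1 : ℝ) 2) : Module ℝ (HGamma α) :=
  inferInstanceAs (Module ℝ (H1WGamma α))

/-- The underlying `L²(Ω)` function of an element of `H¹_Γ(Ω; w)`. -/
def HGamma.fn (α : Set.Ico (1 : ℝ) 2) : HGamma α →ₗ[ℝ] L2 :=
  (WithLp.fstₗ 2 ℝ L2 (WithLp 2 (L2 × L2W α))).comp
    ((H1W α).subtype.comp (H1WGamma α).subtype)

/-- The gradient `u ↦ (∂_θ u, ∂_r u) ∈ L²(Ω) × L²(Ω; r ^ α dz)`. -/
def HGamma.grad (α : Set.Ico (1 : ℝ) 2) : HGamma α →ₗ[ℝ] WithLp 2 (L2 × L2W α) :=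
  (WithLp.sndₗ 2 ℝ L2 (WithLp 2 (L2 × L2W α))).comp
    ((H1W α).subtype.comp (H1WGamma α).subtype)

lemma HGamma.norm_fn_le {α : Set.Ico (1 : ℝ) 2} (x : HGamma α) :
    ‖HGamma.fn α x‖ ≤ 2 * ‖HGamma.grad α x‖ :=
  poincare α x.1 x.2

lemma HGamma.grad_injective (α : Set.Ico (1 : ℝ) 2) : Function.Injective (HGamma.grad α) := by
  rw [injective_iff_map_eq_zero]
  intro x hx
  have h := HGamma.norm_fn_le x
  rw [hx, norm_zero, mul_zero] at h
  have h0 : HGamma.fn α x = 0 := norm_le_zero_iff.1 h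
  exact Subtype.ext (Subtype.ext (WithLp.ofLp_injective 2 (Prod.ext h0 hx)))

/-- The gradient norm `‖u‖ = (∫ ∇u · A∇u dz)^{1/2}`. -/
instance (α : Set.Ico (1 : ℝ) 2) : NormedAddCommGroup (HGamma α) :=
  NormedAddCommGroup.induced (HGamma α) _ (HGamma.grad α) (HGamma.grad_injective α)

/-- The inner product `(u, v) = ∫ ∇u · A∇v dz`. -/
instance (α : Set.Ico (1 : ℝ) 2) : InnerProductSpace ℝ (HGamma α) :=
  InnerProductSpace.induced (HGamma.grad α)

/-- The embedding `H¹_Γ(Ω; w) → L²(Ω)`, `u ↦ u`. -/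
def embedding (α : Set.Ico (1 : ℝ) 2) : HGamma α →L[ℝ] L2 :=
  (HGamma.fn α).mkContinuous 2 HGamma.norm_fn_le

end DegCyl

end

namespace DegCyl

/-! ### Approximation by constants on rectangles -/

/-! Compactness: the embedding is an operator-norm limit of finite-rank operators. Cut the cylinder
into `N²` congruent cells. On each cell a smooth function differs from a suitable constant by a
squared `L²` error of at most `4 (2π/N)² ∫ (∂_θ φ)² + 4 (1/N)^(2-α) ∫ r^α (∂_r φ)²`. Summed over the
cells, this bounds the distance from `φ` to the step functions by `rate α N` times the gradient
norm, and the rate tends to `0` because `α < 2`.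

The degeneracy at `r = 0` is absorbed by a Hardy-type inequality on `(a, b]`: the reference value is
taken at the right endpoint, so the derivative carries the factor `(r - a)²`, which is at most `(b -
a)^(2-α) r^α`. The constant depends only on the length `b - a`, so cells touching `r = 0` need no
special treatment. Orthogonal projection onto step functions carries the bound over to the closure
`H1WGamma α`. Vanishing near `Γ` plays no role in this estimate; it only makes the gradient norm a
norm.

Injectivity has content because elements of the space are triples that record their gradient: `u =
0` has to force a zero weak gradient. A function orthogonal to all test functions `a(θ) b(r)` has,
for almost every `r`, a slice with vanishing Fourier coefficients, hence is zero
(`ae_eq_zero_of_forall_isTest`). -/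

/-- The derivative of `(r - a) (f r - f b)²` integrates to zero: the first factor vanishes at `a`,
the second at `b`. Expanding `0 ≤ ∫ ((f - f b) + 2 (r - a) f')²` and cancelling that derivative
leaves the bound. -/
lemma integral_sub_endpoint_sq_le {f f' : ℝ → ℝ} {a b : ℝ} (hab : a ≤ b)
    (hf : ∀ r, HasDerivAt f (f' r) r) (hf' : Continuous f') :
    ∫ r in Ioc a b, (f r - f b) ^ 2 ≤ 4 * ∫ r in Ioc a b, (r - a) ^ 2 * f' r ^ 2 := by
  have cf : Continuous f := continuous_iff_continuousAt.2 fun r => (hf r).continuousAt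
  rw [← intervalIntegral.integral_of_le hab, ← intervalIntegral.integral_of_le hab]
  have hd : ∀ r ∈ uIcc a b, HasDerivAt (fun r => (r - a) * (f r - f b) ^ 2)
      ((f r - f b) ^ 2 + 2 * ((r - a) * (f r - f b) * f' r)) r := by
    intro r _
    have := ((hasDerivAt_id r).sub_const a).mul (((hf r).sub_const (f b)).pow 2)
    refine this.congr_deriv ?_
    simp only [id_eq, Nat.cast_ofNat, Nat.add_one_sub_one, pow_one, one_mul, Pi.pow_apply]
    ring
  have e1 : ∫ r in a..b, ((f r - f b) ^ 2 + 2 * ((r - a) * (f r - f b) * f' r)) = 0 := by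
    rw [intervalIntegral.integral_eq_sub_of_hasDerivAt hd
      (Continuous.intervalIntegrable (by fun_prop) _ _)]
    simp
  have e2 : 0 ≤ ∫ r in a..b, ((f r - f b) + 2 * ((r - a) * f' r)) ^ 2 :=
    intervalIntegral.integral_nonneg hab fun r _ => sq_nonneg _
  have e3 : (fun r => ((f r - f b) + 2 * ((r - a) * f' r)) ^ 2) =
      fun r => (2 * ((f r - f b) ^ 2 + 2 * ((r - a) * (f r - f b) * f' r)) - (f r - f b) ^ 2)
        + 4 * ((r - a) ^ 2 * f' r ^ 2) := by
    ext r; ring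
  rw [e3, intervalIntegral.integral_add (Continuous.intervalIntegrable (by fun_prop) _ _)
      (Continuous.intervalIntegrable (by fun_prop) _ _),
    intervalIntegral.integral_sub (Continuous.intervalIntegrable (by fun_prop) _ _)
      (Continuous.intervalIntegrable (by fun_prop) _ _),
    intervalIntegral.integral_const_mul, intervalIntegral.integral_const_mul, e1] at e2
  linarith

/-- Since `0 ≤ a`, `(r - a)² = (r - a)^(2-α) (r - a)^α ≤ (b - a)^(2-α) r^α`, uniformly in the
position of the interval. -/
lemma integral_sub_endpoint_sq_le_weighted {f f' : ℝ → ℝ} {a b α : ℝ} (ha : 0 ≤ a) (hab : a < b)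
    (hα0 : 0 ≤ α) (hα : α ≤ 2) (hf : ∀ r, HasDerivAt f (f' r) r) (hf' : Continuous f') :
    ∫ r in Ioc a b, (f r - f b) ^ 2 ≤
      4 * (b - a) ^ (2 - α) * ∫ r in Ioc a b, r ^ α * f' r ^ 2 := by
  refine (integral_sub_endpoint_sq_le hab.le hf hf').trans ?_
  rw [mul_assoc]
  have cw : Continuous fun r : ℝ => r ^ α := Real.continuous_rpow_const hα0
  have hm : ∫ r in Ioc a b, (r - a) ^ 2 * f' r ^ 2 ≤
      ∫ r in Ioc a b, (b - a) ^ (2 - α) * (r ^ α * f' r ^ 2) := by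
    refine setIntegral_mono_on (Continuous.integrableOn_Ioc (by fun_prop))
      (Continuous.integrableOn_Ioc (by fun_prop)) measurableSet_Ioc fun r hr => ?_
    have h0 : 0 < r - a := sub_pos.2 hr.1
    have e : (r - a) ^ 2 = (r - a) ^ (2 - α) * (r - a) ^ α := by
      rw [← Real.rpow_add h0, sub_add_cancel, Real.rpow_two]
    have h1 : (r - a) ^ (2 - α) ≤ (b - a) ^ (2 - α) :=
      Real.rpow_le_rpow h0.le (by linarith [hr.2]) (by linarith)
    have h2 : (r - a) ^ α ≤ r ^ α := Real.rpow_le_rpow h0.le (by linarith) hα0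
    rw [e, ← mul_assoc]
    exact mul_le_mul_of_nonneg_right (mul_le_mul h1 h2 (by positivity)
      (Real.rpow_nonneg (sub_pos.2 hab).le _)) (sq_nonneg _)
  rw [integral_const_mul] at hm
  linarith

lemma integral_sub_sq_le_unweighted {f f' : ℝ → ℝ} {a b : ℝ} (hab : a ≤ b)
    (hf : ∀ r, HasDerivAt f (f' r) r) (hf' : Continuous f') :
    ∫ r in Ioc a b, (f r - f b) ^ 2 ≤ 4 * (b - a) ^ 2 * ∫ r in Ioc a b, f' r ^ 2 := by
  refine (integral_sub_endpoint_sq_le hab hf hf').trans ?_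
  rw [mul_assoc]
  have hm : ∫ r in Ioc a b, (r - a) ^ 2 * f' r ^ 2 ≤
      ∫ r in Ioc a b, (b - a) ^ 2 * f' r ^ 2 := by
    refine setIntegral_mono_on (Continuous.integrableOn_Ioc (by fun_prop))
      (Continuous.integrableOn_Ioc (by fun_prop)) measurableSet_Ioc fun r hr => ?_
    have h0 : 0 < r - a := sub_pos.2 hr.1
    have h1 : r - a ≤ b - a := by linarith [hr.2]
    gcongr
  rw [integral_const_mul] at hm
  linarith

/-- The mean `G` of `g` is its best constant, so moving from `G` to `C` only increases the error.
Moving from `G` to the mean `k` of `p` costs `(b - a) (G - k)²`, which is at most `∫ (g - p)²` by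
Cauchy–Schwarz. -/
lemma integral_sub_average_sq_le {g p : ℝ → ℝ} {a b : ℝ} (hab : a < b) (hg : Continuous g)
    (hp : Continuous p) (C : ℝ) :
    ∫ x in Ioc a b, (g x - (b - a)⁻¹ * ∫ y in Ioc a b, p y) ^ 2 ≤
      (∫ x in Ioc a b, (g x - C) ^ 2) + ∫ x in Ioc a b, (g x - p x) ^ 2 := by
  simp only [← intervalIntegral.integral_of_le hab.le]
  have h0 : 0 < b - a := sub_pos.2 hab
  set k : ℝ := (b - a)⁻¹ * ∫ y in a..b, p y with hk
  set G : ℝ := (b - a)⁻¹ * ∫ y in a..b, g y with hG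
  have ek : ∫ y in a..b, p y = (b - a) * k := by rw [hk]; field_simp
  have eG : ∫ y in a..b, g y = (b - a) * G := by rw [hG]; field_simp
  have expand : ∀ (f : ℝ → ℝ) (hf : Continuous f) (c : ℝ),
      ∫ x in a..b, (f x - c) ^ 2 =
        (∫ x in a..b, f x ^ 2) - 2 * c * (∫ x in a..b, f x) + (b - a) * c ^ 2 := by
    intro f hf c
    have : (fun x => (f x - c) ^ 2) = fun x => f x ^ 2 - 2 * c * f x + c ^ 2 := by
      ext x; ring
    rw [this, intervalIntegral.integral_add (Continuous.intervalIntegrable (by fun_prop) _ _)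
      (Continuous.intervalIntegrable (by fun_prop) _ _),
      intervalIntegral.integral_sub (Continuous.intervalIntegrable (by fun_prop) _ _)
      (Continuous.intervalIntegrable (by fun_prop) _ _), intervalIntegral.integral_const_mul]
    simp
  -- The variance of `g - p` about its mean `G - k`.
  have h1 : 0 ≤ ∫ x in a..b, ((g x - p x) - (G - k)) ^ 2 :=
    intervalIntegral.integral_nonneg hab.le fun r _ => sq_nonneg _
  rw [expand (fun x => g x - p x) (by fun_prop),
    intervalIntegral.integral_sub (hg.intervalIntegrable _ _) (hp.intervalIntegrable _ _),
    ek, eG] at h1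
  rw [expand g hg, expand g hg, eG]
  have h2 : 0 ≤ (b - a) * (C - G) ^ 2 := by positivity
  nlinarith

/-- The mean over the outer edge `r = d` serves all heights `r` at once. At each height the error
splits into an angular one, against `F (b, r)`, and a radial one, against `F (s, d)`; each is then a
one-dimensional estimate. -/
lemma exists_const_integral_sub_sq_le {F F₁ F₂ : ℝ × ℝ → ℝ} {a b c d α : ℝ} (hab : a < b)
    (hc : 0 ≤ c) (hcd : c < d) (hα0 : 0 ≤ α) (hα : α ≤ 2) (hF : Continuous F)
    (h₁ : Continuous F₁) (h₂ : Continuous F₂)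
    (d₁ : ∀ s r, HasDerivAt (fun t => F (t, r)) (F₁ (s, r)) s)
    (d₂ : ∀ s r, HasDerivAt (fun t => F (s, t)) (F₂ (s, r)) r) :
    ∃ k : ℝ, ∫ p in Ioc a b ×ˢ Ioc c d, (F p - k) ^ 2 ≤
      4 * (b - a) ^ 2 * (∫ p in Ioc a b ×ˢ Ioc c d, F₁ p ^ 2) +
      4 * (d - c) ^ (2 - α) * ∫ p in Ioc a b ×ˢ Ioc c d, p.2 ^ α * F₂ p ^ 2 := by
  have cw : Continuous fun p : ℝ × ℝ => p.2 ^ α :=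
    (Real.continuous_rpow_const hα0).comp continuous_snd
  have int : ∀ {f : ℝ × ℝ → ℝ}, Continuous f →
      Integrable f ((volume.restrict (Ioc a b)).prod (volume.restrict (Ioc c d))) := by
    intro f hf
    rw [Measure.prod_restrict]
    exact (hf.continuousOn.integrableOn_compact (isCompact_Icc.prod isCompact_Icc)).mono_set
      (prod_mono Ioc_subset_Icc_self Ioc_subset_Icc_self)
  refine ⟨(b - a)⁻¹ * ∫ y in Ioc a b, F (y, d), ?_⟩
  set k : ℝ := (b - a)⁻¹ * ∫ y in Ioc a b, F (y, d) with hk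
  rw [Measure.volume_eq_prod, ← Measure.prod_restrict]
  have i0 := int (f := fun p => (F p - k) ^ 2) (by fun_prop)
  have i1 := int (f := fun p => (F p - F (b, p.2)) ^ 2) (by fun_prop)
  have i2 := int (f := fun p => (F p - F (p.1, d)) ^ 2) (by fun_prop)
  have i3 := int (f := fun p => F₁ p ^ 2) (by fun_prop)
  have i4 := int (f := fun p => p.2 ^ α * F₂ p ^ 2) (by fun_prop)
  have b1 : ∫ p, (F p - k) ^ 2 ∂((volume.restrict (Ioc a b)).prod (volume.restrict (Ioc c d))) ≤
      (∫ p, (F p - F (b, p.2)) ^ 2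
        ∂((volume.restrict (Ioc a b)).prod (volume.restrict (Ioc c d)))) +
      ∫ p, (F p - F (p.1, d)) ^ 2
        ∂((volume.restrict (Ioc a b)).prod (volume.restrict (Ioc c d))) := by
    rw [integral_prod_symm _ i0, integral_prod_symm _ i1, integral_prod_symm _ i2,
      ← integral_add i1.integral_prod_right i2.integral_prod_right]
    refine integral_mono i0.integral_prod_right
      (i1.integral_prod_right.add i2.integral_prod_right) fun r => ?_
    exact integral_sub_average_sq_le (g := fun s => F (s, r)) (p := fun s => F (s, d)) hab
      (by fun_prop) (by fun_prop) (F (b, r))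
  refine b1.trans (add_le_add ?_ ?_)
  · rw [integral_prod_symm _ i1, integral_prod_symm _ i3, ← integral_const_mul]
    refine integral_mono i1.integral_prod_right (i3.integral_prod_right.const_mul _) fun r => ?_
    exact integral_sub_sq_le_unweighted (f := fun s => F (s, r)) (f' := fun s => F₁ (s, r))
      hab.le (fun s => d₁ s r) (by fun_prop)
  · rw [integral_prod _ i2, integral_prod _ i4, ← integral_const_mul]
    refine integral_mono i2.integral_prod_left (i4.integral_prod_left.const_mul _) fun s => ?_
    exact integral_sub_endpoint_sq_le_weighted (f := fun r => F (s, r))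
      (f' := fun r => F₂ (s, r)) hc hcd hα0 hα (fun r => d₂ s r) (by fun_prop)

end DegCyl

namespace DegCyl

/-! ### Approximation by step functions -/

/-- The angle in `(0, 2π]` and the radius of a point of the cylinder. -/
noncomputable def chart (z : Cyl) : ℝ × ℝ :=
  ((AddCircle.equivIoc (2 * Real.pi) 0 z.1 : ℝ), z.2)

lemma measurable_chart : Measurable chart :=
  ((measurable_subtype_coe.comp (AddCircle.measurableEquivIoc (2 * Real.pi) 0).measurable).comp
    measurable_fst).prodMk measurable_snd

lemma chart_mem (z : Cyl) : (chart z).1 ∈ Ioc 0 (2 * Real.pi) := by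
  simpa [chart] using (AddCircle.equivIoc (2 * Real.pi) 0 z.1).2

lemma chart_coe {s : ℝ} (hs : s ∈ Ioc 0 (2 * Real.pi)) (r : ℝ) :
    chart ((s : AddCircle (2 * Real.pi)), r) = (s, r) := by
  have : s ∈ Ioc 0 (0 + 2 * Real.pi) := by simpa using hs
  simp [chart, AddCircle.equivIoc_coe_eq this]

lemma measurePreserving_cover :
    MeasurePreserving (fun p : ℝ × ℝ => (((p.1 : AddCircle (2 * Real.pi)), p.2) : Cyl))
      (volume.restrict (Ioc 0 (2 * Real.pi) ×ˢ Ioc 0 1)) mu := by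
  have h := (AddCircle.measurePreserving_mk (2 * Real.pi) 0).prod
    (MeasurePreserving.id ((volume : Measure ℝ).restrict (Ioo 0 1)))
  rw [zero_add, Measure.restrict_congr_set (Ioo_ae_eq_Ioc (a := (0 : ℝ)) (b := 1)),
    Measure.prod_restrict] at h
  rw [mu, Measure.restrict_congr_set (Ioo_ae_eq_Ioc (a := (0 : ℝ)) (b := 1))]
  exact h

lemma setIntegral_chart_preimage {S : Set (ℝ × ℝ)} (hS : MeasurableSet S)
    (hS' : S ⊆ Ioc 0 (2 * Real.pi) ×ˢ Ioc 0 1) {F : Cyl → ℝ} (hF : Continuous F) :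
    ∫ z in chart ⁻¹' S, F z ∂mu = ∫ p in S, F ((p.1 : AddCircle (2 * Real.pi)), p.2) := by
  have hm := measurePreserving_cover
  have hD : MeasurableSet (chart ⁻¹' S) := measurable_chart hS
  rw [← hm.map_eq, setIntegral_map hD hF.aestronglyMeasurable hm.measurable.aemeasurable,
    Measure.restrict_restrict (hm.measurable hD)]
  congr 2
  ext ⟨s, r⟩
  constructor
  · rintro ⟨h1, h2⟩
    have := chart_coe h2.1 r
    rwa [mem_preimage, mem_preimage, this] at h1
  · intro h
    refine ⟨?_, hS' h⟩
    rwa [mem_preimage, mem_preimage, chart_coe (hS' h).1 r]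

/-- The rectangle with index `(i, j)` in the partition of `(0, 2π] × (0, 1]` into `N²` congruent
rectangles. -/
noncomputable def rect (N : ℕ) (i : Fin N × Fin N) : Set (ℝ × ℝ) :=
  Ioc (2 * Real.pi * (i.1 / N)) (2 * Real.pi * ((i.1 + 1) / N)) ×ˢ
    Ioc ((i.2 : ℝ) / N) ((i.2 + 1 : ℝ) / N)

lemma measurableSet_rect (N : ℕ) (i : Fin N × Fin N) : MeasurableSet (rect N i) :=
  measurableSet_Ioc.prod measurableSet_Ioc

lemma Ioc_div_subset (N : ℕ) (i : Fin N) :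
    Ioc ((i : ℝ) / N) ((i + 1 : ℝ) / N) ⊆ Ioc 0 1 := by
  refine Ioc_subset_Ioc (by positivity) ?_
  have : ((i : ℕ) : ℝ) + 1 ≤ N := by exact_mod_cast i.2
  exact div_le_one_of_le₀ this (by positivity)

lemma exists_mem_Ioc_div {N : ℕ} (hN : 0 < N) {t : ℝ} (ht : t ∈ Ioc (0 : ℝ) 1) :
    ∃ i : Fin N, t ∈ Ioc ((i : ℝ) / N) ((i + 1 : ℝ) / N) := by
  have hN' : (0 : ℝ) < N := by exact_mod_cast hN
  -- The intervals are closed on the right, so the index of the one containing `t` is `⌈t * N⌉₊ -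
  -- 1`.
  have hpos : 0 < ⌈t * N⌉₊ := Nat.ceil_pos.2 (mul_pos ht.1 hN')
  have hle : ⌈t * N⌉₊ ≤ N := Nat.ceil_le.2 (by nlinarith [ht.2])
  obtain ⟨m, hm⟩ : ∃ m, ⌈t * N⌉₊ = m + 1 := ⟨_, (Nat.succ_pred_eq_of_pos hpos).symm⟩
  refine ⟨⟨m, by omega⟩, ?_, ?_⟩
  · rw [div_lt_iff₀ hN']
    exact Nat.lt_ceil.1 (by rw [hm]; exact m.lt_succ_self)
  · rw [le_div_iff₀ hN']
    have := Nat.le_ceil (t * N)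
    rw [hm] at this
    exact_mod_cast this

lemma eq_of_mem_Ioc_div {N : ℕ} {t : ℝ} {i j : Fin N}
    (hi : t ∈ Ioc ((i : ℝ) / N) ((i + 1 : ℝ) / N))
    (hj : t ∈ Ioc ((j : ℝ) / N) ((j + 1 : ℝ) / N)) : i = j := by
  have hN' : (0 : ℝ) < N := by exact_mod_cast i.pos
  have h1 := (div_lt_div_iff_of_pos_right hN').1 (hi.1.trans_le hj.2)
  have h2 := (div_lt_div_iff_of_pos_right hN').1 (hj.1.trans_le hi.2)
  have h1' : (i : ℕ) < j + 1 := by exact_mod_cast h1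
  have h2' : (j : ℕ) < i + 1 := by exact_mod_cast h2
  exact Fin.ext (by omega)

lemma mem_rect_iff {N : ℕ} {i : Fin N × Fin N} {p : ℝ × ℝ} :
    p ∈ rect N i ↔ p.1 / (2 * Real.pi) ∈ Ioc ((i.1 : ℝ) / N) ((i.1 + 1 : ℝ) / N) ∧
      p.2 ∈ Ioc ((i.2 : ℝ) / N) ((i.2 + 1 : ℝ) / N) := by
  rw [rect, mem_prod, mem_Ioc, @mem_Ioc _ _ _ _ (p.1 / (2 * Real.pi)), lt_div_iff₀' Real.two_pi_pos,
    div_le_iff₀' Real.two_pi_pos]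

lemma rect_subset (N : ℕ) (i : Fin N × Fin N) : rect N i ⊆ Ioc 0 (2 * Real.pi) ×ˢ Ioc 0 1 := by
  intro p hp
  rw [mem_rect_iff] at hp
  have h := Ioc_div_subset N _ hp.1
  rw [mem_Ioc, lt_div_iff₀' Real.two_pi_pos, div_le_iff₀' Real.two_pi_pos, mul_zero, mul_one] at h
  exact ⟨h, Ioc_div_subset N _ hp.2⟩

/-- The cells of the partition of the cylinder. -/
noncomputable def cell (N : ℕ) (i : Fin N × Fin N) : Set Cyl := chart ⁻¹' rect N i

lemma measurableSet_cell (N : ℕ) (i : Fin N × Fin N) : MeasurableSet (cell N i) :=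
  measurable_chart (measurableSet_rect N i)

lemma eq_of_mem_cell {N : ℕ} {i j : Fin N × Fin N} {z : Cyl} (hi : z ∈ cell N i)
    (hj : z ∈ cell N j) : i = j := by
  have hi := mem_rect_iff.1 hi
  have hj := mem_rect_iff.1 hj
  exact Prod.ext (eq_of_mem_Ioc_div hi.1 hj.1) (eq_of_mem_Ioc_div hi.2 hj.2)

lemma iUnion_cell_ae_eq {N : ℕ} (hN : 0 < N) : (⋃ i, cell N i) =ᵐ[mu] univ := by
  rw [ae_eq_univ_iff_measure_eq (MeasurableSet.iUnion (measurableSet_cell N)).nullMeasurableSet]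
  refine measure_congr (Filter.eventuallyEq_univ.2 ?_)
  filter_upwards [ae_mem] with z hz
  have h : (chart z).1 / (2 * Real.pi) ∈ Ioc (0 : ℝ) 1 := by
    have := chart_mem z
    exact ⟨div_pos this.1 Real.two_pi_pos, div_le_one_of_le₀ this.2 Real.two_pi_pos.le⟩
  obtain ⟨i, hi⟩ := exists_mem_Ioc_div hN h
  obtain ⟨j, hj⟩ := exists_mem_Ioc_div hN (Ioo_subset_Ioc_self hz)
  exact mem_iUnion.2 ⟨(i, j), mem_rect_iff.2 ⟨hi, hj⟩⟩

lemma sum_setIntegral_cell {N : ℕ} (hN : 0 < N) {F : Cyl → ℝ} (hF : Integrable F mu) :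
    ∑ i, ∫ z in cell N i, F z ∂mu = ∫ z, F z ∂mu := by
  rw [← integral_iUnion_fintype (measurableSet_cell N) _ fun i => hF.integrableOn,
    setIntegral_congr_set (iUnion_cell_ae_eq hN), setIntegral_univ]
  exact fun i j hij => disjoint_left.2 fun z hi hj => hij (eq_of_mem_cell hi hj)

/-- The finite-dimensional space of functions that are constant on each cell. -/
noncomputable def stepSpace (N : ℕ) : Submodule ℝ L2 :=
  Submodule.span ℝ (range fun i : Fin N × Fin N =>
    indicatorConstLp 2 (measurableSet_cell N i) (measure_ne_top mu _) (1 : ℝ))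

instance (N : ℕ) : FiniteDimensional ℝ (stepSpace N) :=
  FiniteDimensional.span_of_finite ℝ (finite_range _)

lemma exists_mem_stepSpace {N : ℕ} (hN : 0 < N) (u : L2) (k : Fin N × Fin N → ℝ) :
    ∃ v ∈ stepSpace N, ‖u - v‖ ^ 2 = ∑ i, ∫ z in cell N i, (u z - k i) ^ 2 ∂mu := by
  let e : Fin N × Fin N → L2 := fun i =>
    indicatorConstLp 2 (measurableSet_cell N i) (measure_ne_top mu _) (1 : ℝ)
  refine ⟨∑ i, k i • e i, Submodule.sum_mem _ fun i _ => Submodule.smul_mem _ _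
    (Submodule.subset_span (mem_range_self i)), ?_⟩
  have hv : ∀ᵐ z ∂mu, (∑ i, k i • e i : L2) z = ∑ i, k i * (cell N i).indicator 1 z := by
    have h1 : ∀ᵐ z ∂mu, ∀ i, (k i • e i : L2) z = k i * (cell N i).indicator 1 z := by
      refine ae_all_iff.2 fun i => ?_
      filter_upwards [Lp.coeFn_smul (k i) (e i), indicatorConstLp_coeFn (p := 2)
        (hs := measurableSet_cell N i) (hμs := measure_ne_top mu _) (c := (1 : ℝ))] with z h h'
      rw [h, Pi.smul_apply, h', smul_eq_mul]
      rfl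
    filter_upwards [h1, Lp.coeFn_finsetSum Finset.univ fun i => k i • e i] with z h h'
    rw [h', Finset.sum_apply]
    exact Finset.sum_congr rfl fun i _ => h i
  rw [norm_sq_Lp, ← sum_setIntegral_cell hN ((Lp.memLp _).integrable_sq)]
  refine Finset.sum_congr rfl fun i _ => ?_
  refine setIntegral_congr_ae (measurableSet_cell N i) ?_
  filter_upwards [hv, Lp.coeFn_sub u (∑ i, k i • e i)] with z h h' hz
  -- On cell `i` the indicators of all other cells vanish by disjointness.
  rw [h', Pi.sub_apply, h, Finset.sum_eq_single i]
  · simp [hz]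
  · intro j _ hj
    simp [indicator_of_notMem fun hz' => hj (eq_of_mem_cell hz' hz)]
  · simp

/-- `dTheta` differentiates along rotations at time `0`; translating by `s` gives the derivative of
the periodic lift at `s`. -/
lemma Smooth.hasDerivAt_dTheta_coe {φ : Cyl → ℝ} (h : Smooth φ) (s r : ℝ) :
    HasDerivAt (fun t : ℝ => φ ((t : AddCircle (2 * Real.pi)), r))
      (dTheta φ ((s : AddCircle (2 * Real.pi)), r)) s := by
  have h1 := h.hasDerivAt_dTheta ((s : AddCircle (2 * Real.pi)), r)
  have h2 : HasDerivAt (fun t : ℝ => t - s) 1 s := (hasDerivAt_id s).sub_const s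
  rw [← sub_self s] at h1
  have h3 := HasDerivAt.comp (h := fun t : ℝ => t - s) s h1 h2
  rw [mul_one] at h3
  have e : (fun t : ℝ => φ ((t : AddCircle (2 * Real.pi)), r)) =
      fun t : ℝ => φ ((s : AddCircle (2 * Real.pi)) + ((t - s : ℝ) : AddCircle (2 * Real.pi)), r) := by
    ext t
    rw [← AddCircle.coe_add, add_sub_cancel]
  rw [e]
  exact h3

/-- All cells have the same sides `2π/N` and `1/N`, so the constants factor out and the cell
integrals add up to global ones. -/
lemma exists_mem_stepSpace_norm_sub_sq_le {N : ℕ} (hN : 0 < N) (α : Set.Ico (1 : ℝ) 2)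
    {φ : Cyl → ℝ} (hφ : Smooth φ) (u : L2) (hu : u =ᵐ[mu] φ) :
    ∃ v ∈ stepSpace N, ‖u - v‖ ^ 2 ≤
      4 * (2 * Real.pi / N) ^ 2 * (∫ z, dTheta φ z ^ 2 ∂mu) +
      4 * (1 / N : ℝ) ^ (2 - (α : ℝ)) * ∫ z, dR φ z ^ 2 ∂(muW α) := by
  have hα0 : (0 : ℝ) ≤ α := by linarith [α.2.1]
  have hN' : (0 : ℝ) < N := by exact_mod_cast hN
  have cw : Continuous fun z : Cyl => z.2 ^ (α : ℝ) :=
    (Real.continuous_rpow_const hα0).comp continuous_snd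
  have c := hφ.continuous
  have c1 := hφ.continuous_dTheta
  have c2 := hφ.continuous_dR
  have cq : Continuous fun p : ℝ × ℝ => (((p.1 : AddCircle (2 * Real.pi)), p.2) : Cyl) :=
    isOpenQuotientMap_cover.continuous
  have key : ∀ i : Fin N × Fin N, ∃ k : ℝ, ∫ z in cell N i, (φ z - k) ^ 2 ∂mu ≤
      4 * (2 * Real.pi / N) ^ 2 * (∫ z in cell N i, dTheta φ z ^ 2 ∂mu) +
      4 * (1 / N : ℝ) ^ (2 - (α : ℝ)) * ∫ z in cell N i, z.2 ^ (α : ℝ) * dR φ z ^ 2 ∂mu := by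
    intro i
    have w1 : 2 * Real.pi * ((i.1 + 1) / N) - 2 * Real.pi * (i.1 / N) = 2 * Real.pi / N := by
      ring
    have w2 : ((i.2 : ℝ) + 1) / N - i.2 / N = 1 / N := by ring
    have w1' : 0 < 2 * Real.pi / N := div_pos Real.two_pi_pos hN'
    have w2' : 0 < 1 / (N : ℝ) := by positivity
    obtain ⟨k, hk⟩ := exists_const_integral_sub_sq_le (sub_pos.1 (w1 ▸ w1'))
      (div_nonneg (Nat.cast_nonneg (i.2 : ℕ)) hN'.le) (sub_pos.1 (w2 ▸ w2')) hα0 α.2.2.le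
      (c.comp cq) (c1.comp cq) (c2.comp cq) (fun s r => hφ.hasDerivAt_dTheta_coe s r)
      (fun s r => hφ.hasDerivAt_dR ((s : AddCircle (2 * Real.pi)), r))
    refine ⟨k, ?_⟩
    rw [w1, w2] at hk
    have hS := measurableSet_rect N i
    have hS' := rect_subset N i
    unfold cell
    rw [setIntegral_chart_preimage hS hS' (by fun_prop),
      setIntegral_chart_preimage hS hS' (by fun_prop),
      setIntegral_chart_preimage hS hS' (by fun_prop)]
    exact hk
  choose k hk using key
  obtain ⟨v, hv, e⟩ := exists_mem_stepSpace hN u k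
  refine ⟨v, hv, ?_⟩
  have e' : ∀ i, ∫ z in cell N i, (u z - k i) ^ 2 ∂mu = ∫ z in cell N i, (φ z - k i) ^ 2 ∂mu :=
    fun i => integral_congr_ae (ae_restrict_of_ae (hu.mono fun z hz => by simp only [hz]))
  rw [e, integral_muW, ← sum_setIntegral_cell hN (F := fun z => dTheta φ z ^ 2)
      (integrable_of_continuous (c1.pow 2)),
    ← sum_setIntegral_cell hN (F := fun z => z.2 ^ (α : ℝ) * dR φ z ^ 2)
      (integrable_of_continuous (cw.mul (c2.pow 2))), Finset.mul_sum,
    Finset.mul_sum, ← Finset.sum_add_distrib]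
  exact Finset.sum_le_sum fun i _ => (e' i).trans_le (hk i)

/-! ### Convergence of the step-function projections and compactness -/

lemma norm_sub_starProjection_le {E : Type*} [NormedAddCommGroup E] [InnerProductSpace ℝ E]
    (K : Submodule ℝ E) [K.HasOrthogonalProjection] (u : E) {v : E} (hv : v ∈ K) :
    ‖u - K.starProjection u‖ ≤ ‖u - v‖ := by
  rw [Submodule.starProjection_minimal]
  exact ciInf_le ⟨0, by rintro _ ⟨x, rfl⟩; exact norm_nonneg _⟩ (⟨v, hv⟩ : K)

/-- The rate at which step functions on `N²` cells approximate `H¹_Γ(Ω; w)`. -/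
noncomputable def rate (α : Set.Ico (1 : ℝ) 2) (N : ℕ) : ℝ :=
  Real.sqrt (4 * (2 * Real.pi / N) ^ 2 + 4 * (1 / N : ℝ) ^ (2 - (α : ℝ)))

lemma tendsto_rate (α : Set.Ico (1 : ℝ) 2) :
    Filter.Tendsto (rate α) Filter.atTop (nhds 0) := by
  have h1 : Filter.Tendsto (fun N : ℕ => 2 * Real.pi / N) Filter.atTop (nhds 0) :=
    tendsto_const_div_atTop_nhds_zero_nat _
  have h2 : Filter.Tendsto (fun N : ℕ => (1 / N : ℝ) ^ (2 - (α : ℝ))) Filter.atTop (nhds 0) := by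
    have hα : 0 < 2 - (α : ℝ) := sub_pos.2 α.2.2
    have := (tendsto_const_div_atTop_nhds_zero_nat (1 : ℝ)).rpow_const
      (p := 2 - (α : ℝ)) (Or.inr hα.le)
    rwa [Real.zero_rpow hα.ne'] at this
  have h := (((h1.pow 2).const_mul 4).add (h2.const_mul 4)).sqrt
  have e : Real.sqrt (4 * 0 ^ 2 + 4 * 0) = 0 := by simp
  rw [e] at h
  exact h

lemma rate_nonneg (α : Set.Ico (1 : ℝ) 2) (N : ℕ) : 0 ≤ rate α N := Real.sqrt_nonneg _

/-- The projection is the best approximant and depends continuously on `u`, so the bound is a closed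
condition and passes from smooth functions to the closure. -/
lemma norm_fst_sub_starProjection_le {N : ℕ} (hN : 0 < N) (α : Set.Ico (1 : ℝ) 2) (x : H1W α)
    (hx : x ∈ H1WGamma α) :
    ‖(x : Triple α).fst - (stepSpace N).starProjection (x : Triple α).fst‖ ≤
      rate α N * ‖(x : Triple α).snd‖ := by
  have hcl : IsClosed {x : H1W α |
      ‖(x : Triple α).fst - (stepSpace N).starProjection (x : Triple α).fst‖ ≤
        rate α N * ‖(x : Triple α).snd‖} := by
    have c1 : Continuous fun x : H1W α => (x : Triple α).fst :=
      (WithLp.fstL 2 ℝ L2 (WithLp 2 (L2 × L2W α))).continuous.comp continuous_subtype_val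
    have c2 : Continuous fun x : H1W α => (x : Triple α).snd :=
      (WithLp.sndL 2 ℝ L2 (WithLp 2 (L2 × L2W α))).continuous.comp continuous_subtype_val
    exact isClosed_le (c1.sub ((stepSpace N).starProjection.continuous.comp c1)).norm
      (continuous_const.mul c2.norm)
  refine closure_minimal (s := (CGamma α : Set (H1W α))) ?_ hcl hx
  rintro y ⟨φ, hφ, h1, h2, h3⟩
  obtain ⟨v, hv, hle⟩ := exists_mem_stepSpace_norm_sub_sq_le hN α hφ.smooth _ h1
  have e2 : ‖(y : Triple α).snd.fst‖ ^ 2 = ∫ z, dTheta φ z ^ 2 ∂mu := by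
    rw [norm_sq_Lp]
    exact integral_congr_ae (h2.mono fun z hz => by simp only [hz])
  have e3 : ‖(y : Triple α).snd.snd‖ ^ 2 = ∫ z, dR φ z ^ 2 ∂(muW α) := by
    rw [norm_sq_Lp]
    exact integral_congr_ae (h3.mono fun z hz => by simp only [hz])
  have e4 := WithLp.prod_norm_sq_eq_of_L2 (y : Triple α).snd
  refine (norm_sub_starProjection_le _ _ hv).trans ?_
  have p2 : 0 ≤ 4 * (1 / N : ℝ) ^ (2 - (α : ℝ)) := by positivity
  have p1 : 0 ≤ 4 * (2 * Real.pi / N) ^ 2 := by positivity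
  refine (sq_le_sq₀ (norm_nonneg _) (mul_nonneg (rate_nonneg α N) (norm_nonneg _))).1 ?_
  rw [mul_pow, e4, rate, Real.sq_sqrt (add_nonneg p1 p2)]
  rw [← e2, ← e3] at hle
  -- The product of `rate α N ^ 2` with the squared gradient norm contains the wanted terms and two
  -- nonnegative cross terms.
  nlinarith [mul_nonneg p1 (sq_nonneg ‖(y : Triple α).snd.snd‖),
    mul_nonneg p2 (sq_nonneg ‖(y : Triple α).snd.fst‖)]

lemma isCompactOperator_embedding (α : Set.Ico (1 : ℝ) 2) :
    IsCompactOperator (embedding α) := by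
  let P : ℕ → (HGamma α →L[ℝ] L2) := fun N => (stepSpace N).starProjection.comp (embedding α)
  have hP : Filter.Tendsto P Filter.atTop (nhds (embedding α)) := by
    refine (tendsto_iff_norm_sub_tendsto_zero (E := HGamma α →L[ℝ] L2)).2 ?_
    refine squeeze_zero' (Filter.Eventually.of_forall fun N =>
      ContinuousLinearMap.opNorm_nonneg _) ?_ (tendsto_rate α)
    filter_upwards [Filter.eventually_gt_atTop 0] with N hN
    refine ContinuousLinearMap.opNorm_le_bound _ (rate_nonneg α N) fun x => ?_
    rw [sub_apply, norm_sub_rev]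
    exact norm_fst_sub_starProjection_le hN α x.1 x.2
  refine isCompactOperator_of_tendsto hP (Filter.Eventually.of_forall fun N => ?_)
  -- The projected embedding factors through the finite-dimensional `stepSpace N`, whose inclusion
  -- is compact.
  exact ((isCompactOperator_of_locallyCompactSpace_rng (stepSpace N).subtypeL).comp_clm
    ((stepSpace N).orthogonalProjectionOnto.comp (embedding α)))

end DegCyl

namespace DegCyl

/-! ### Functions orthogonal to all test functions -/

lemma isTest_mul {a : AddCircle (2 * Real.pi) → ℝ} {b : ℝ → ℝ}
    (ha : ContDiff ℝ ∞ fun s : ℝ => a s) (hb : ContDiff ℝ ∞ b) (hbc : HasCompactSupport b)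
    (hbs : tsupport b ⊆ Ioo 0 1) : IsTest fun z => a z.1 * b z.2 where
  smooth := (ha.comp contDiff_fst).mul (hb.comp contDiff_snd)
  compact := by
    refine HasCompactSupport.intro (isCompact_univ.prod hbc.isCompact) fun z hz => ?_
    have : z.2 ∉ tsupport b := fun h => hz ⟨mem_univ _, h⟩
    rw [image_eq_zero_of_notMem_tsupport this, mul_zero]
  support := by
    refine (closure_minimal (t := univ ×ˢ tsupport b) ?_
      (isClosed_univ.prod (isClosed_tsupport b))).trans (prod_mono le_rfl hbs)
    intro z hz
    exact ⟨mem_univ _, subset_tsupport b (right_ne_zero_of_mul hz)⟩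

lemma contDiff_fourier_re (n : ℤ) :
    ContDiff ℝ ∞ fun s : ℝ => (fourier n (s : AddCircle (2 * Real.pi))).re := by
  simp only [fourier_coe_apply]
  refine Complex.reCLM.contDiff.comp (ContDiff.cexp ?_)
  exact (contDiff_const.mul Complex.ofRealCLM.contDiff).div_const _

lemma contDiff_fourier_im (n : ℤ) :
    ContDiff ℝ ∞ fun s : ℝ => (fourier n (s : AddCircle (2 * Real.pi))).im := by
  simp only [fourier_coe_apply]
  refine Complex.imCLM.contDiff.comp (ContDiff.cexp ?_)
  exact (contDiff_const.mul Complex.ofRealCLM.contDiff).div_const _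

/-- Completeness of the Fourier basis in complex `L²`, applied to a real function: the real and
imaginary parts of its `n`th coefficient are, up to normalization, the two given integrals at index
`-n`. -/
lemma ae_eq_zero_of_integral_fourier_eq_zero {f : AddCircle (2 * Real.pi) → ℝ}
    (hf : MemLp f 2 volume) (hre : ∀ n : ℤ, ∫ θ, f θ * (fourier n θ).re = 0)
    (him : ∀ n : ℤ, ∫ θ, f θ * (fourier n θ).im = 0) : f =ᵐ[volume] 0 := by
  have hfC : MemLp (fun θ => (f θ : ℂ)) 2 AddCircle.haarAddCircle := hf.ofReal.haarAddCircle
  have hi : Integrable f volume := hf.integrable (by norm_num)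
  have hcoef : ∀ n : ℤ, fourierCoeff (fun θ => (f θ : ℂ)) n = 0 := by
    intro n
    rw [fourierCoeff, AddCircle.integral_haarAddCircle]
    have hint : Integrable (fun θ => fourier (-n) θ • (f θ : ℂ)) volume :=
      hi.ofReal.bdd_mul (c := 1) (map_continuous _).aestronglyMeasurable
        (Filter.Eventually.of_forall fun θ => by simp [Circle.norm_coe])
    have : ∫ θ, fourier (-n) θ • (f θ : ℂ) = 0 := by
      refine Complex.ext ?_ ?_
      · rw [← Complex.reCLM_apply, ← Complex.reCLM.integral_comp_comm hint, Complex.zero_re,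
          ← hre (-n)]
        exact integral_congr_ae (Filter.Eventually.of_forall fun θ => by simp [mul_comm])
      · rw [← Complex.imCLM_apply, ← Complex.imCLM.integral_comp_comm hint, Complex.zero_im,
          ← him (-n)]
        exact integral_congr_ae (Filter.Eventually.of_forall fun θ => by simp [mul_comm])
    rw [this, smul_zero]
  have h0 : hfC.toLp _ = 0 := by
    apply (fourierBasis (T := 2 * Real.pi)).repr.injective
    ext n
    rw [fourierBasis_repr, fourierCoeff_congr_ae hfC.coeFn_toLp, hcoef]
    simp
  have h1 : (fun θ => (f θ : ℂ)) =ᵐ[AddCircle.haarAddCircle] 0 :=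
    hfC.coeFn_toLp.symm.trans (h0 ▸ Lp.coeFn_zero ..)
  rw [AddCircle.volume_eq_smul_haarAddCircle]
  refine (Measure.smul_absolutelyContinuous (c := ENNReal.ofReal (2 * Real.pi))).ae_le
    (h1.mono fun θ h => ?_)
  exact Complex.ofReal_eq_zero.1 h

/-- Testing with `a(θ) b(r)` and Fubini reduce this to the fundamental lemma of the calculus of
variations on `(0, 1)`. That lemma needs only local integrability, which matters since only `r^β g`,
not `g`, is assumed integrable up to `r = 0`. -/
lemma ae_integral_mul_eq_zero {g : Cyl → ℝ} {β : ℝ}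
    (hg : Integrable (fun z => z.2 ^ β * g z) mu)
    (hi : ∀ φ, IsTest φ → Integrable (fun z => g z * φ z) mu)
    (h0 : ∀ φ, IsTest φ → ∫ z, g z * φ z ∂mu = 0)
    {a : AddCircle (2 * Real.pi) → ℝ} (ha : ContDiff ℝ ∞ fun s : ℝ => a s) :
    ∀ᵐ r ∂((volume : Measure ℝ).restrict (Ioo 0 1)), ∫ θ, g (θ, r) * a θ = 0 := by
  have ca : Continuous a := (QuotientAddGroup.isOpenQuotientMap_mk
    (N := AddSubgroup.zmultiples (2 * Real.pi))).continuous_comp_iff.1 ha.continuous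
  obtain ⟨C, hC⟩ := isCompact_univ.exists_bound_of_continuousOn ca.continuousOn
  have hga : Integrable (fun z : Cyl => z.2 ^ β * g z * a z.1) mu :=
    hg.mul_bdd (c := C) (ca.comp continuous_fst).aestronglyMeasurable
      (Filter.Eventually.of_forall fun z => hC z.1 (mem_univ _))
  have hloc : LocallyIntegrableOn (fun r => ∫ θ, g (θ, r) * a θ) (Ioo (0 : ℝ) 1) volume := by
    have h1 : IntegrableOn (fun r => ∫ θ, r ^ β * g (θ, r) * a θ) (Ioo (0 : ℝ) 1) volume :=
      hga.integral_prod_right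
    -- The weight is divided out again; its inverse is continuous on the open interval, though
    -- possibly unbounded.
    have hc : ContinuousOn (fun r : ℝ => r ^ (-β)) (Ioo 0 1) := fun r hr =>
      (Real.continuousAt_rpow_const r (-β) (Or.inl hr.1.ne')).continuousWithinAt
    have h2 := h1.locallyIntegrableOn.continuousOn_mul hc isOpen_Ioo.isLocallyClosed
    refine h2.congr ?_
    filter_upwards [ae_restrict_mem measurableSet_Ioo] with r hr
    have e : r ^ (-β) * r ^ β = 1 := by rw [← Real.rpow_add hr.1]; simp
    simp only [mul_assoc, integral_const_mul]
    rw [← mul_assoc, e, one_mul]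
  rw [ae_restrict_iff' measurableSet_Ioo]
  refine isOpen_Ioo.ae_eq_zero_of_integral_contDiff_smul_eq_zero hloc fun b hb hbc hbs => ?_
  have ht := isTest_mul ha hb hbc hbs
  have h1 := h0 _ ht
  have h2 := hi _ ht
  unfold mu at h1 h2
  rw [integral_prod_symm _ h2] at h1
  rw [← setIntegral_eq_integral_of_forall_compl_eq_zero (s := Ioo 0 1)]
  · refine Eq.trans ?_ h1
    refine integral_congr_ae (Filter.Eventually.of_forall fun r => ?_)
    simp only [← mul_assoc, integral_mul_const, smul_eq_mul]
    rw [mul_comm]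
  · intro r hr
    rw [image_eq_zero_of_notMem_tsupport fun h => hr (hbs h), zero_smul]

/-- Countably many Fourier modes share one null set of radii. Off it, and for almost every radius,
the slice is in `L²`, because `r^β` is a nonzero constant there, and so it vanishes. Fubini for `r^β
g²` turns this into vanishing almost everywhere. The exponent `β` covers both gradient components:
`0` for `∂_θ` and `α` for `∂_r`. -/
lemma ae_eq_zero_of_forall_isTest {g : Cyl → ℝ} {β : ℝ}
    (hg : Integrable (fun z => z.2 ^ β * g z) mu)
    (hg2 : Integrable (fun z => z.2 ^ β * g z ^ 2) mu)
    (hi : ∀ φ, IsTest φ → Integrable (fun z => g z * φ z) mu)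
    (h0 : ∀ φ, IsTest φ → ∫ z, g z * φ z ∂mu = 0) : g =ᵐ[mu] 0 := by
  have hre := ae_all_iff.2 fun n : ℤ => ae_integral_mul_eq_zero hg hi h0
    (a := fun θ => (fourier n θ).re) (contDiff_fourier_re n)
  have him := ae_all_iff.2 fun n : ℤ => ae_integral_mul_eq_zero hg hi h0
    (a := fun θ => (fourier n θ).im) (contDiff_fourier_im n)
  have hslice : ∀ᵐ r ∂((volume : Measure ℝ).restrict (Ioo 0 1)),
      ∫ θ, r ^ β * g (θ, r) ^ 2 = 0 := by
    filter_upwards [hre, him, hg.prod_left_ae, hg2.prod_left_ae,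
      ae_restrict_mem measurableSet_Ioo] with r h1 h2 h3 h4 hr
    have hne : r ^ β ≠ 0 := (Real.rpow_pos_of_pos hr.1 _).ne'
    rw [integrable_const_mul_iff hne.isUnit] at h3 h4
    have h5 := ae_eq_zero_of_integral_fourier_eq_zero
      ((memLp_two_iff_integrable_sq h3.aestronglyMeasurable).2 h4) h1 h2
    refine integral_eq_zero_of_ae (h5.mono fun θ h => ?_)
    have : g (θ, r) = 0 := h
    simp [this]
  have hz : ∫ z, z.2 ^ β * g z ^ 2 ∂mu = 0 := by
    unfold mu at hg2 ⊢
    rw [integral_prod_symm _ hg2]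
    exact integral_eq_zero_of_ae hslice
  rw [integral_eq_zero_iff_of_nonneg_ae _ hg2] at hz
  · filter_upwards [hz, ae_mem] with z h h'
    have hne : z.2 ^ β ≠ 0 := (Real.rpow_pos_of_pos h'.1 _).ne'
    have h : z.2 ^ β * g z ^ 2 = 0 := h
    simpa [hne] using h
  · filter_upwards [ae_mem] with z h
    exact mul_nonneg (Real.rpow_nonneg h.1.le _) (sq_nonneg _)

/-! ### Uniqueness of the weak gradient and injectivity -/

lemma eq_zero_of_fst_eq_zero {α : Set.Ico (1 : ℝ) 2} (x : H1W α)
    (hx : (x : Triple α).fst = 0) : x = 0 := by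
  have h0 : ((x : Triple α).fst : Cyl → ℝ) =ᵐ[mu] 0 := hx ▸ Lp.coeFn_zero ..
  have hw : IsWeakGrad (x : Triple α).fst (x : Triple α).snd.fst (x : Triple α).snd.snd := x.2
  have e1 : (x : Triple α).snd.fst = 0 := by
    rw [Lp.eq_zero_iff_ae_eq_zero]
    refine ae_eq_zero_of_forall_isTest (β := 0) ?_ ?_
      (fun φ hφ => integrable_mul_of_continuous _ hφ.smooth.continuous) fun φ hφ => ?_
    · simpa using (Lp.memLp (x : Triple α).snd.fst).integrable (by norm_num)
    · simpa using (Lp.memLp (x : Triple α).snd.fst).integrable_sq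
    · have := (hw φ hφ).1
      rw [integral_mul_zero h0] at this
      linarith
  have e2 : (x : Triple α).snd.snd = 0 := by
    rw [Lp.eq_zero_iff_ae_eq_zero]
    -- Vanishing is obtained `mu`-almost everywhere and transferred to `muW α`, which is absolutely
    -- continuous with respect to `mu`.
    refine (withDensity_absolutelyContinuous _ _).ae_le
      (ae_eq_zero_of_forall_isTest (β := (α : ℝ)) ?_ ?_
        (fun φ hφ => integrable_mul_test α _ hφ) fun φ hφ => ?_)
    · exact (integrable_muW_iff α _).1
        ((Lp.memLp (x : Triple α).snd.snd).integrable (by norm_num))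
    · exact (integrable_muW_iff α _).1 (Lp.memLp (x : Triple α).snd.snd).integrable_sq
    · have := (hw φ hφ).2
      rw [integral_mul_zero h0] at this
      linarith
  exact Subtype.ext (WithLp.ofLp_injective 2 (Prod.ext hx
    (WithLp.ofLp_injective 2 (Prod.ext e1 e2))))

lemma embedding_injective (α : Set.Ico (1 : ℝ) 2) : Function.Injective (embedding α) := by
  rw [injective_iff_map_eq_zero]
  intro x hx
  exact Subtype.ext (eq_zero_of_fst_eq_zero x.1 hx)

end DegCyl

theorem lemma2p5 (α : Set.Ico (1 : ℝ) 2) :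
    Function.Injective (DegCyl.embedding α) ∧ IsCompactOperator (DegCyl.embedding α) :=
  ⟨DegCyl.embedding_injective α, DegCyl.isCompactOperator_embedding α⟩
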